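/- All graphs are finite and simple. Let $G$ be a graph with no universal vertex, i.e. $N_G[v]\neq V(G)$ for every vertex $v$, where $N_G[v]=\{v\}\cup\{w : vw\in E(G)\}$. For a clique $K$ of $G$ (a possibly empty, not necessarily maximal set of pairwise adjacent vertices), let $G^K$ be the graph with vertex set $V(G)$ in which two distinct vertices are adjacent according to the following rules: - $u,u'\in V(G)\setminus K$ are adjacent in $G^K$ if and only if $uu'\in E(G)$; - $v,v'\in K$ are adjacent in $G^K$ if and only if $N_G[v]\cup N_G[v']\neq V(G)$ or $vv'$ is an edge of an induced cycle on four vertices of $G$; - $v\in K$ and $u\in V(G)\setminus K$ are adjacent in $G^K$ if and only if $uv\notin E(G)$, or $uv\in E(G)$ and $N_G[u]\not\subseteq N_G[v]$. An interval model of a graph $H$ assigns to each vertex $x$ a nonempty closed interval $I(x)=[\mathrm{lp}(x),\mathrm{rp}(x)]$ of the real line so that two distinct vertices are adjacent in $H$ if and only if their intervals intersect. The interval $I(v)$ doubly extends $I(u)$ if $\mathrm{lp}(v)<\mathrm{lp}(u)\le \mathrm{rp}(u)<\mathrm{rp}(v)$. A graph is a circular-arc graph if one can assign to each vertex a closed arc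 of a circle so that two distinct vertices are adjacent if and only if their arcs intersect. Then $G$ is a circular-arc graph if and only if there is a clique $K$ of $G$ such that $G^K$ satisfies the following condition. $(\sharp)$ $G^K$ admits an interval model in which, for all $v\in K$ and $u\in V(G)\setminus K$, the interval of $v$ doubly extends the interval of $u$ if and only if $uv\notin E(G)$. -/

import Mathlib

namespace CircArc

/-- The closed neighbourhood `N[v] = N(v) ∪ {v}`. -/
def closedNbhd {V : Type*} (G : SimpleGraph V) (v : V) : Set V :=
  insert v (G.neighborSet v)

/-- The closed arc of the circle `ℝ / ℤ` that runs in the positive direction from (the image of)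
`a` to (the image of) `b`; used for `a ≤ b < a + 1`. -/
def arc (a b : ℝ) : Set UnitAddCircle :=
  (fun x : ℝ => (x : UnitAddCircle)) '' Set.Icc a b

/-- A set of points of the circle is a closed arc; single points are allowed,
and the whole circle is not an arc. -/
def IsArc (S : Set UnitAddCircle) : Prop :=
  ∃ a b : ℝ, a ≤ b ∧ b < a + 1 ∧ S = arc a b

/-- `G` is a circular-arc graph: it is the intersection graph of a family of arcs of a circle. -/
def IsCircularArcGraph {V : Type*} (G : SimpleGraph V) : Prop :=
  ∃ A : V → Set UnitAddCircle, (∀ v, IsArc (A v)) ∧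
    ∀ u v, u ≠ v → (G.Adj u v ↔ (A u ∩ A v).Nonempty)

/-- An interval model of `H`: an assignment of nonempty closed real intervals `[lp v, rp v]` to
the vertices such that distinct vertices are adjacent iff their intervals intersect. -/
structure IntervalModel {V : Type*} (H : SimpleGraph V) where
  lp : V → ℝ
  rp : V → ℝ
  lp_le_rp : ∀ v, lp v ≤ rp v
  adj_iff : ∀ u v, u ≠ v →
    (H.Adj u v ↔ (Set.Icc (lp u) (rp u) ∩ Set.Icc (lp v) (rp v)).Nonempty)

/-- The interval of `v` doubly extends the interval of `u`. -/
def IntervalModel.DoublyExtends {V : Type*} {H : SimpleGraph V} (I : IntervalModel H)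
    (v u : V) : Prop :=
  I.lp v < I.lp u ∧ I.lp u ≤ I.rp u ∧ I.rp u < I.rp v

/-- `vv'` is an edge of an induced cycle `v v' w w'` on four vertices of `G`. -/
def IsEdgeOfC4 {V : Type*} (G : SimpleGraph V) (v v' : V) : Prop :=
  ∃ w w' : V, v ≠ w ∧ v' ≠ w' ∧
    G.Adj v v' ∧ G.Adj v' w ∧ G.Adj w w' ∧ G.Adj w' v ∧ ¬ G.Adj v w ∧ ¬ G.Adj v' w'

theorem IsEdgeOfC4.symm {V : Type*} {G : SimpleGraph V} {v v' : V}
    (h : IsEdgeOfC4 G v v') : IsEdgeOfC4 G v' v := by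
  obtain ⟨w, w', h1, h2, h3, h4, h5, h6, h7, h8⟩ := h
  exact ⟨w', w, h2, h1, h3.symm, h6.symm, h5.symm, h4.symm, h8, h7⟩

/-- The auxiliary graph `G^K` on the vertex set of `G`. -/
def auxGraph {V : Type*} (G : SimpleGraph V) (K : Set V) : SimpleGraph V where
  Adj x y := x ≠ y ∧
    ((x ∉ K ∧ y ∉ K ∧ G.Adj x y) ∨
     (x ∈ K ∧ y ∈ K ∧
        (closedNbhd G x ∪ closedNbhd G y ≠ Set.univ ∨ IsEdgeOfC4 G x y)) ∨
     (x ∈ K ∧ y ∉ K ∧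
        (¬ G.Adj x y ∨ (G.Adj x y ∧ ¬ closedNbhd G y ⊆ closedNbhd G x))) ∨
     (y ∈ K ∧ x ∉ K ∧
        (¬ G.Adj y x ∨ (G.Adj y x ∧ ¬ closedNbhd G x ⊆ closedNbhd G y))))
  symm := ⟨by
    rintro x y ⟨hne, h⟩
    refine ⟨hne.symm, ?_⟩
    rcases h with ⟨hx, hy, h⟩ | ⟨hx, hy, h⟩ | h | h
    · exact Or.inl ⟨hy, hx, h.symm⟩
    · refine Or.inr (Or.inl ⟨hy, hx, ?_⟩)
      rw [Set.union_comm]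
      exact h.imp id IsEdgeOfC4.symm
    · exact Or.inr (Or.inr (Or.inr h))
    · exact Or.inr (Or.inr (Or.inl h))⟩
  loopless := ⟨fun _ h => h.1 rfl⟩

/-- Condition `♯`: the graph `G^K` admits an interval model in which, for all `v ∈ K` and
`u ∉ K`, the interval of `v` doubly extends the interval of `u` iff `uv` is not an edge of `G`. -/
def SatisfiesSharp {V : Type*} (G : SimpleGraph V) (K : Set V) : Prop :=
  ∃ I : IntervalModel (auxGraph G K),
    ∀ v ∈ K, ∀ u ∉ K, (I.DoublyExtends v u ↔ ¬ G.Adj u v)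

end CircArc

/-
A circular-arc model is cut open at a point of the circle. The vertices whose arcs contain that
point form a clique `K`; the other arcs become intervals `[p u, q u]`, and the arc of `v ∈ K`
becomes the complement of an open interval `(p v, q v)`, which contains `[p u, q u]` exactly when
`uv` is not an edge. Shrink `(p v, q v)` to the convex hull of the intervals of the non-neighbours
of `v`. Two such hulls meet exactly when two of the intervals spanning them meet, and this is
precisely adjacency in `G^K`. To let every hull strictly extend the intervals that it contains, its
ends are taken as cuts of the line with a tie-breaking rank; countably many such cuts embed in `ℝ`.
Conversely, an interval model as in `♯` is itself a cut-open circular-arc model. Universal vertices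
can be moved out of `K` by giving them an interval that contains all the others.
-/

namespace CircArc

section ClosedNbhd

variable {V : Type*} {G : SimpleGraph V} {u v w : V}

theorem mem_closedNbhd : w ∈ closedNbhd G v ↔ w = v ∨ G.Adj v w := Iff.rfl

theorem notMem_closedNbhd : w ∉ closedNbhd G v ↔ w ≠ v ∧ ¬ G.Adj v w := by
  rw [mem_closedNbhd, not_or]

theorem self_mem_closedNbhd : v ∈ closedNbhd G v := Set.mem_insert v _

theorem mem_closedNbhd_comm : w ∈ closedNbhd G v ↔ v ∈ closedNbhd G w := by
  rw [mem_closedNbhd, mem_closedNbhd, eq_comm, G.adj_comm]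

theorem mem_closedNbhd_iff_adj (hne : v ≠ w) : w ∈ closedNbhd G v ↔ G.Adj v w :=
  or_iff_right hne.symm

theorem closedNbhd_eq_univ_iff : closedNbhd G v = Set.univ ↔ G.IsUniversal v :=
  SimpleGraph.insert_neighborSet_eq_univ

theorem forall_adj_iff_inter_nonempty {X : Type*} {A : V → Set X} (hA : ∀ v, (A v).Nonempty) :
    (∀ u v, u ≠ v → (G.Adj u v ↔ (A u ∩ A v).Nonempty)) ↔
      ∀ u v, v ∈ closedNbhd G u ↔ (A u ∩ A v).Nonempty := by
  refine forall₂_congr fun u v => ?_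
  obtain rfl | hne := eq_or_ne u v
  · simp [self_mem_closedNbhd, hA]
  · simp [mem_closedNbhd_iff_adj, hne]

end ClosedNbhd

section Arc

variable {a b c d p q : ℝ}

theorem coe_unitAddCircle_eq_iff {x y : ℝ} :
    (x : UnitAddCircle) = y ↔ ∃ n : ℤ, x = y + n := by
  rw [← sub_eq_zero, ← AddCircle.coe_sub, AddCircle.coe_eq_zero_iff]
  simp only [zsmul_eq_mul, mul_one, eq_comm, sub_eq_iff_eq_add']

theorem zero_mem_arc_iff : 0 ∈ arc a b ↔ ∃ n : ℤ, a ≤ n ∧ n ≤ b := by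
  constructor
  · rintro ⟨x, hx, hx0⟩
    obtain ⟨n, rfl⟩ := coe_unitAddCircle_eq_iff.1 (hx0.trans (AddCircle.coe_zero 1).symm)
    exact ⟨n, by simpa using hx⟩
  · rintro ⟨n, hn⟩
    exact ⟨n, hn, (coe_unitAddCircle_eq_iff.2 ⟨n, by simp⟩).trans (AddCircle.coe_zero 1)⟩

theorem arc_inter_arc_nonempty_iff :
    (arc a b ∩ arc c d).Nonempty ↔
      ∃ n : ℤ, (Set.Icc a b ∩ Set.Icc (c + n) (d + n)).Nonempty := by
  constructor
  · rintro ⟨_, ⟨x, hx, rfl⟩, ⟨y, hy, hyx⟩⟩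
    obtain ⟨n, rfl⟩ := coe_unitAddCircle_eq_iff.1 hyx.symm
    exact ⟨n, y + n, hx, by simpa using hy⟩
  · rintro ⟨n, x, hx, hx'⟩
    exact ⟨x, ⟨x, hx, rfl⟩, x - n, ⟨by linarith [hx'.1], by linarith [hx'.2]⟩,
      coe_unitAddCircle_eq_iff.2 ⟨-n, by push_cast; ring⟩⟩

theorem arc_add_intCast (n : ℤ) : arc (a + n) (b + n) = arc a b := by
  simp only [arc, ← Set.image_add_const_Icc, Set.image_image]
  exact Set.image_congr fun x _ => coe_unitAddCircle_eq_iff.2 ⟨n, rfl⟩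

theorem Icc_inter_Icc_nonempty_iff {α : Type*} [LinearOrder α] {a b c d : α} (hab : a ≤ b)
    (hcd : c ≤ d) : (Set.Icc a b ∩ Set.Icc c d).Nonempty ↔ a ≤ d ∧ c ≤ b := by
  rw [Set.Icc_inter_Icc, Set.nonempty_Icc, sup_le_iff, le_inf_iff, le_inf_iff]
  tauto

theorem arc_inter_arc_nonempty_iff_of_pos_of_lt_one (ha : 0 < a) (hab : a ≤ b) (hb : b < 1)
    (hc : 0 < c) (hcd : c ≤ d) (hd : d < 1) :
    (arc a b ∩ arc c d).Nonempty ↔ a ≤ d ∧ c ≤ b := by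
  rw [arc_inter_arc_nonempty_iff, ← Icc_inter_Icc_nonempty_iff hab hcd]
  constructor
  · rintro ⟨n, x, hx, hx'⟩
    have hn : -1 < n := by exact_mod_cast (by linarith [hx.1, hx'.2] : (-1 : ℝ) < n)
    have hn' : n < 1 := by exact_mod_cast (by linarith [hx.2, hx'.1] : (n : ℝ) < 1)
    obtain rfl : n = 0 := by omega
    exact ⟨x, hx, by simpa using hx'⟩
  · exact fun h => ⟨0, by simpa using h⟩

theorem arc_inter_arc_sub_one_nonempty_iff (ha : 0 < a) (hab : a ≤ b) (hb : b < 1)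
    (hp : 0 ≤ p) (hpq : p < q) (hq : q ≤ 1) :
    (arc a b ∩ arc (q - 1) p).Nonempty ↔ a ≤ p ∨ q ≤ b := by
  rw [arc_inter_arc_nonempty_iff]
  constructor
  · rintro ⟨n, x, hx, hx'⟩
    have hn : -1 < n := by exact_mod_cast (by linarith [hx.1, hx'.2] : (-1 : ℝ) < n)
    have hn' : n < 2 := by exact_mod_cast (by linarith [hx.2, hx'.1] : (n : ℝ) < 2)
    obtain rfl | rfl : n = 0 ∨ n = 1 := by omega
    · exact Or.inl (by simpa using hx.1.trans hx'.2)
    · exact Or.inr (by simpa using hx'.1.trans hx.2)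
  · rintro (h | h)
    · exact ⟨0, a, ⟨le_rfl, hab⟩, by push_cast; linarith, by simpa using h⟩
    · exact ⟨1, b, ⟨hab, le_rfl⟩, by simpa using h, by push_cast; linarith⟩

theorem IsArc.nonempty {S : Set UnitAddCircle} (hS : IsArc S) : S.Nonempty := by
  obtain ⟨a, b, hab, -, rfl⟩ := hS
  exact ⟨a, a, ⟨le_rfl, hab⟩, rfl⟩

theorem IsArc.exists_eq_arc_sub_one {S : Set UnitAddCircle} (hS : IsArc S) (h0 : 0 ∈ S) :
    ∃ p q : ℝ, 0 ≤ p ∧ p < q ∧ q ≤ 1 ∧ S = arc (q - 1) p := by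
  obtain ⟨a, b, -, hba, rfl⟩ := hS
  obtain ⟨n, han, hnb⟩ := zero_mem_arc_iff.1 h0
  refine ⟨b - n, a - n + 1, by linarith, by linarith, by linarith, ?_⟩
  rw [← arc_add_intCast (-n)]
  congr 1 <;> push_cast <;> ring

theorem IsArc.exists_eq_arc {S : Set UnitAddCircle} (hS : IsArc S) (h0 : 0 ∉ S) :
    ∃ p q : ℝ, 0 < p ∧ p ≤ q ∧ q < 1 ∧ S = arc p q := by
  obtain ⟨a, b, hab, -, rfl⟩ := hS
  have no_int : ∀ n : ℤ, a ≤ n → b < n := by simpa [zero_mem_arc_iff] using h0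
  have floor_lt : (⌊a⌋ : ℝ) < a :=
    (Int.floor_le a).lt_of_ne fun h => (no_int ⌊a⌋ h.ge).not_ge (h.le.trans hab)
  have lt_floor : b < ⌊a⌋ + 1 := by
    exact_mod_cast no_int (⌊a⌋ + 1) (by exact_mod_cast (Int.lt_floor_add_one a).le)
  refine ⟨a - ⌊a⌋, b - ⌊a⌋, by linarith, by linarith, by linarith, ?_⟩
  rw [← arc_add_intCast (-⌊a⌋)]
  push_cast
  rfl

end Arc

section Core

variable {V : Type*} {G : SimpleGraph V} {K : Set V} {u v : V}

open Classical in
/-- The vertices whose intervals the interval of `x` has to span in an interval model of `G^K`: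
the non-neighbours of `x` if `x ∈ K`, and only `x` itself otherwise. -/
noncomputable def core (G : SimpleGraph V) (K : Set V) (x : V) : Set V :=
  if x ∈ K then (closedNbhd G x)ᶜ else {x}

theorem core_of_mem (hv : v ∈ K) : core G K v = (closedNbhd G v)ᶜ := if_pos hv

theorem core_of_notMem (hu : u ∉ K) : core G K u = {u} := if_neg hu

theorem notMem_of_mem_core (hK : G.IsClique K) (hu : u ∈ core G K v) : u ∉ K := by
  by_cases hv : v ∈ K
  · rw [core_of_mem hv, Set.mem_compl_iff, notMem_closedNbhd] at hu
    exact fun huK => hu.2 (hK hv huK hu.1.symm)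
  · rw [core_of_notMem hv] at hu
    exact hu ▸ hv

theorem core_nonempty (huniv : v ∈ K → ¬ G.IsUniversal v) : (core G K v).Nonempty := by
  by_cases hv : v ∈ K
  · rw [core_of_mem hv, Set.nonempty_compl, Ne, closedNbhd_eq_univ_iff]
    exact huniv hv
  · rw [core_of_notMem hv]
    exact Set.singleton_nonempty v

theorem closedNbhd_union_ne_univ_or_isEdgeOfC4_iff (hadj : G.Adj u v) :
    (closedNbhd G u ∪ closedNbhd G v ≠ Set.univ ∨ IsEdgeOfC4 G u v) ↔
      ∃ a ∉ closedNbhd G u, ∃ b ∉ closedNbhd G v, b ∈ closedNbhd G a := by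
  constructor
  · rintro (hne | ⟨w, w', huw, hvw', -, -, hww', -, hnuw, hnvw'⟩)
    · obtain ⟨w, hw⟩ := (Set.ne_univ_iff_exists_notMem _).1 hne
      rw [Set.mem_union, not_or] at hw
      exact ⟨w, hw.1, w, hw.2, self_mem_closedNbhd⟩
    · exact ⟨w, notMem_closedNbhd.2 ⟨huw.symm, hnuw⟩, w', notMem_closedNbhd.2 ⟨hvw'.symm, hnvw'⟩,
        Or.inr hww'⟩
  · rintro ⟨a, hau, b, hbv, hab⟩
    refine or_iff_not_imp_left.2 fun hcover => ?_
    have cover (w : V) : w ∈ closedNbhd G u ∨ w ∈ closedNbhd G v :=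
      Set.eq_univ_iff_forall.1 (not_not.1 hcover) w
    have hav : a ∈ closedNbhd G v := (cover a).resolve_left hau
    have hbu : b ∈ closedNbhd G u := (cover b).resolve_right hbv
    rw [notMem_closedNbhd] at hau hbv
    have hva : G.Adj v a := hav.resolve_left (by rintro rfl; exact hau.2 hadj)
    have hub : G.Adj u b := hbu.resolve_left (by rintro rfl; exact hbv.2 hadj.symm)
    have hab' : G.Adj a b := hab.resolve_left (by rintro rfl; exact hau.2 hub)
    exact ⟨a, b, hau.1.symm, hbv.1.symm, hadj, hva, hab', hub.symm, hau.2, hbv.2⟩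

theorem auxGraph_adj_iff_of_mem_of_notMem (hv : v ∈ K) (hu : u ∉ K) :
    (auxGraph G K).Adj v u ↔ ¬ closedNbhd G u ⊆ closedNbhd G v := by
  have hne : v ≠ u := ne_of_mem_of_not_mem hv hu
  have subset_adj : closedNbhd G u ⊆ closedNbhd G v → G.Adj v u := fun h =>
    (mem_closedNbhd_iff_adj hne).1 (h self_mem_closedNbhd)
  simp only [auxGraph, hv, hu]
  tauto

theorem auxGraph_adj_iff (hK : G.IsClique K) (hne : u ≠ v) :
    (auxGraph G K).Adj u v ↔ ∃ a ∈ core G K u, ∃ b ∈ core G K v, b ∈ closedNbhd G a := by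
  have mixed {u v : V} (hv : v ∈ K) (hu : u ∉ K) :
      (auxGraph G K).Adj v u ↔ ∃ a ∈ core G K v, ∃ b ∈ core G K u, b ∈ closedNbhd G a := by
    simp [auxGraph_adj_iff_of_mem_of_notMem hv hu, core_of_mem hv, core_of_notMem hu,
      Set.not_subset, and_comm, mem_closedNbhd_comm (v := u)]
  by_cases hu : u ∈ K <;> by_cases hv : v ∈ K
  · rw [core_of_mem hu, core_of_mem hv]
    refine Iff.trans ?_ (closedNbhd_union_ne_univ_or_isEdgeOfC4_iff (hK hu hv hne))
    simp [auxGraph, hu, hv, hne]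
  · exact mixed hu hv
  · rw [SimpleGraph.adj_comm, mixed hv hu]
    exact ⟨fun ⟨b, hb, a, ha, hab⟩ => ⟨a, ha, b, hb, mem_closedNbhd_comm.1 hab⟩,
      fun ⟨a, ha, b, hb, hab⟩ => ⟨b, hb, a, ha, mem_closedNbhd_comm.1 hab⟩⟩
  · simp [auxGraph, core_of_notMem, hu, hv, hne, mem_closedNbhd_iff_adj]

end Core

section FlippedModel

variable {V α β : Type*} [LinearOrder α] [LinearOrder β] {G : SimpleGraph V} {K : Set V}
  {p q : V → α} {u v : V}

/-- A circular-arc model of `G` cut open at a point of the circle: a vertex `u ∉ K` has the closed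
interval `[p u, q u]` as its arc, while the arc of a vertex `v ∈ K` contains the cut point and is
the complement of the open interval `(p v, q v)`. -/
structure IsFlippedModel (G : SimpleGraph V) (K : Set V) (p q : V → α) : Prop where
  isClique : G.IsClique K
  mem_closedNbhd_iff : ∀ u ∉ K, ∀ u' ∉ K, u' ∈ closedNbhd G u ↔ p u ≤ q u' ∧ p u' ≤ q u
  notMem_closedNbhd_iff : ∀ v ∈ K, ∀ u ∉ K, u ∉ closedNbhd G v ↔ p v < p u ∧ q u < q v

namespace IsFlippedModel

theorem le (h : IsFlippedModel G K p q) (hu : u ∉ K) : p u ≤ q u :=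
  ((h.mem_closedNbhd_iff u hu u hu).1 self_mem_closedNbhd).1

theorem lt (h : IsFlippedModel G K p q) (hv : v ∈ K) (huniv : ¬ G.IsUniversal v) :
    p v < q v := by
  obtain ⟨u, hvu⟩ := core_nonempty (K := K) fun _ => huniv
  have hu : u ∉ K := notMem_of_mem_core h.isClique hvu
  rw [core_of_mem hv] at hvu
  obtain ⟨hp, hq⟩ := (h.notMem_closedNbhd_iff v hv u hu).1 hvu
  exact hp.trans_le (h.le hu) |>.trans hq

theorem comp (h : IsFlippedModel G K p q) {f : α → β} (hf : StrictMono f) :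
    IsFlippedModel G K (f ∘ p) (f ∘ q) where
  isClique := h.isClique
  mem_closedNbhd_iff := by simpa [hf.le_iff_le] using h.mem_closedNbhd_iff
  notMem_closedNbhd_iff := by simpa [hf.lt_iff_lt] using h.notMem_closedNbhd_iff

open Classical in
theorem diff_isUniversal [BoundedOrder α] (h : IsFlippedModel G K p q) :
    IsFlippedModel G (K \ {v | G.IsUniversal v}) (fun v => if G.IsUniversal v then ⊥ else p v)
      (fun v => if G.IsUniversal v then ⊤ else q v) where
  isClique := h.isClique.subset Set.sdiff_subset
  mem_closedNbhd_iff u hu u' hu' := by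
    by_cases huniv : G.IsUniversal u
    · simp [huniv, closedNbhd_eq_univ_iff.2 huniv]
    by_cases huniv' : G.IsUniversal u'
    · simp [huniv', mem_closedNbhd_comm (v := u), closedNbhd_eq_univ_iff.2 huniv']
    simp only [huniv, huniv', if_false]
    exact h.mem_closedNbhd_iff u (fun huK => hu ⟨huK, huniv⟩) u' fun huK' => hu' ⟨huK', huniv'⟩
  notMem_closedNbhd_iff v hv u hu := by
    by_cases huniv : G.IsUniversal u
    · simp [huniv, mem_closedNbhd_comm (v := v), closedNbhd_eq_univ_iff.2 huniv]
    simp only [huniv, show ¬ G.IsUniversal v from hv.2, if_false]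
    exact h.notMem_closedNbhd_iff v hv.1 u fun huK => hu ⟨huK, huniv⟩

theorem exists_forall_not_isUniversal_and_mem_Ioo {p q : V → ℝ} (h : IsFlippedModel G K p q) :
    ∃ (K' : Set V) (p' q' : V → ℝ), IsFlippedModel G K' p' q' ∧
      (∀ v ∈ K', ¬ G.IsUniversal v) ∧ ∀ v, p' v ∈ Set.Ioo 0 1 ∧ q' v ∈ Set.Ioo 0 1 := by
  let f : unitInterval → ℝ := fun t => (t + 1) / 3
  have hf : StrictMono f := fun s t hst => by
    have : (s : ℝ) < t := hst
    simp only [f]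
    linarith
  have hf_mem (t : unitInterval) : f t ∈ Set.Ioo 0 1 := by
    constructor <;> simp only [f] <;> linarith [t.2.1, t.2.2]
  exact ⟨_, _, _, (h.comp unitInterval.sigmoid_strictMono).diff_isUniversal.comp hf,
    fun _ hv => hv.2, fun _ => ⟨hf_mem _, hf_mem _⟩⟩

end IsFlippedModel

theorem isFlippedModel_iff_arc_inter_nonempty {A : V → Set UnitAddCircle} {p q : V → ℝ}
    (hK : ∀ v ∈ K, 0 ≤ p v ∧ p v < q v ∧ q v ≤ 1 ∧ A v = arc (q v - 1) (p v))
    (hKc : ∀ u ∉ K, 0 < p u ∧ p u ≤ q u ∧ q u < 1 ∧ A u = arc (p u) (q u)) :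
    IsFlippedModel G K p q ↔ ∀ u v, v ∈ closedNbhd G u ↔ (A u ∩ A v).Nonempty := by
  have zero_mem {v} (hv : v ∈ K) : 0 ∈ A v := by
    obtain ⟨hp, -, hq, hA⟩ := hK v hv
    exact hA ▸ zero_mem_arc_iff.2 ⟨0, by simpa using hq, by simpa using hp⟩
  have outer {u u'} (hu : u ∉ K) (hu' : u' ∉ K) :
      (A u ∩ A u').Nonempty ↔ p u ≤ q u' ∧ p u' ≤ q u := by
    obtain ⟨hp, hpq, hq, hA⟩ := hKc u hu
    obtain ⟨hp', hpq', hq', hA'⟩ := hKc u' hu'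
    rw [hA, hA', arc_inter_arc_nonempty_iff_of_pos_of_lt_one hp hpq hq hp' hpq' hq']
  have mixed {v u} (hv : v ∈ K) (hu : u ∉ K) :
      ¬ (A v ∩ A u).Nonempty ↔ p v < p u ∧ q u < q v := by
    obtain ⟨hp, hpq, hq, hA⟩ := hKc u hu
    obtain ⟨hp', hpq', hq', hA'⟩ := hK v hv
    rw [Set.inter_comm, hA, hA', arc_inter_arc_sub_one_nonempty_iff hp hpq hq hp' hpq' hq',
      not_or, not_le, not_le]
  constructor
  · intro h u v
    by_cases hu : u ∈ K <;> by_cases hv : v ∈ K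
    · refine iff_of_true ?_ ⟨0, zero_mem hu, zero_mem hv⟩
      exact or_iff_not_imp_left.2 fun hne => h.isClique hu hv (Ne.symm hne)
    · rw [← not_iff_not, h.notMem_closedNbhd_iff u hu v hv, mixed hu hv]
    · rw [← not_iff_not, mem_closedNbhd_comm, h.notMem_closedNbhd_iff v hv u hu, Set.inter_comm,
        mixed hv hu]
    · rw [h.mem_closedNbhd_iff u hu v hv, outer hu hv]
  · intro h
    refine ⟨fun v hv v' hv' hne => ?_, fun u hu u' hu' => ?_, fun v hv u hu => ?_⟩
    · exact (mem_closedNbhd_iff_adj hne).1 ((h v v').2 ⟨0, zero_mem hv, zero_mem hv'⟩)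
    · rw [h, outer hu hu']
    · rw [h, mixed hv hu]

theorem IsCircularArcGraph.exists_isFlippedModel (h : IsCircularArcGraph G) :
    ∃ (K : Set V) (p q : V → ℝ), IsFlippedModel G K p q := by
  obtain ⟨A, hA, hadj⟩ := h
  have endpoints (v : V) : ∃ p q : ℝ,
      (0 ∈ A v → 0 ≤ p ∧ p < q ∧ q ≤ 1 ∧ A v = arc (q - 1) p) ∧
      (0 ∉ A v → 0 < p ∧ p ≤ q ∧ q < 1 ∧ A v = arc p q) := by
    by_cases h0 : 0 ∈ A v
    · obtain ⟨p, q, hpq⟩ := (hA v).exists_eq_arc_sub_one h0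
      exact ⟨p, q, fun _ => hpq, absurd h0⟩
    · obtain ⟨p, q, hpq⟩ := (hA v).exists_eq_arc h0
      exact ⟨p, q, fun h => absurd h h0, fun _ => hpq⟩
  choose p q hK hKc using endpoints
  exact ⟨{v | 0 ∈ A v}, p, q, (isFlippedModel_iff_arc_inter_nonempty hK hKc).2
    ((forall_adj_iff_inter_nonempty fun v => (hA v).nonempty).1 hadj)⟩

theorem IsFlippedModel.isCircularArcGraph {p q : V → ℝ} (h : IsFlippedModel G K p q) :
    IsCircularArcGraph G := by
  classical
  obtain ⟨K, p, q, h, huniv, hmem⟩ := h.exists_forall_not_isUniversal_and_mem_Ioo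
  let A : V → Set UnitAddCircle := fun v =>
    if v ∈ K then arc (q v - 1) (p v) else arc (p v) (q v)
  have hK : ∀ v ∈ K, 0 ≤ p v ∧ p v < q v ∧ q v ≤ 1 ∧ A v = arc (q v - 1) (p v) := fun v hv =>
    ⟨(hmem v).1.1.le, h.lt hv (huniv v hv), (hmem v).2.2.le, if_pos hv⟩
  have hKc : ∀ u ∉ K, 0 < p u ∧ p u ≤ q u ∧ q u < 1 ∧ A u = arc (p u) (q u) := fun u hu =>
    ⟨(hmem u).1.1, h.le hu, (hmem u).2.2, if_neg hu⟩
  have hA (v : V) : IsArc (A v) := by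
    obtain ⟨⟨hp, -⟩, -, hq⟩ := hmem v
    by_cases hv : v ∈ K
    · obtain ⟨-, hpq, -, hAv⟩ := hK v hv
      exact ⟨_, _, by linarith, by linarith, hAv⟩
    · obtain ⟨-, hpq, -, hAv⟩ := hKc v hv
      exact ⟨_, _, hpq, by linarith, hAv⟩
  exact ⟨A, hA, (forall_adj_iff_inter_nonempty fun v => (hA v).nonempty).2
    ((isFlippedModel_iff_arc_inter_nonempty hK hKc).1 h)⟩

theorem SatisfiesSharp.exists_isFlippedModel (hK : G.IsClique K) (h : SatisfiesSharp G K) :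
    ∃ p q : V → ℝ, IsFlippedModel G K p q := by
  obtain ⟨I, hI⟩ := h
  refine ⟨I.lp, I.rp, hK, fun u hu u' hu' => ?_, fun v hv u hu => ?_⟩
  · obtain rfl | hne := eq_or_ne u u'
    · simp [self_mem_closedNbhd, I.lp_le_rp]
    · rw [← Icc_inter_Icc_nonempty_iff (I.lp_le_rp u) (I.lp_le_rp u'), ← I.adj_iff u u' hne,
        mem_closedNbhd_iff_adj hne]
      simp [auxGraph, hu, hu', hne]
  · rw [mem_closedNbhd_iff_adj (ne_of_mem_of_not_mem hv hu), G.adj_comm, ← hI v hv u hu]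
    simp [IntervalModel.DoublyExtends, I.lp_le_rp]

end FlippedModel

section Hull

variable {V α : Type*} [LinearOrder α] {G : SimpleGraph V} {K : Set V} {p q : V → α} {u v : V}

theorem exists_le_and_le_of_crossing {ι : Type*} {p q : ι → α} {A B : Set ι}
    (hle : ∀ i ∈ A ∪ B, p i ≤ q i)
    (hA : ∀ a ∈ A, ∀ a' ∈ A, ∀ b ∈ B, q a < p b → q b < p a' → b ∈ A)
    (hB : ∀ b ∈ B, ∀ b' ∈ B, ∀ a ∈ A, q b < p a → q a < p b' → a ∈ B)
    (hAB : ∃ a ∈ A, ∃ b ∈ B, p a ≤ q b) (hBA : ∃ b ∈ B, ∃ a ∈ A, p b ≤ q a) :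
    ∃ a ∈ A, ∃ b ∈ B, p a ≤ q b ∧ p b ≤ q a := by
  obtain ⟨a, ha, b, hb, hab⟩ := hAB
  obtain ⟨b', hb', a', ha', hba'⟩ := hBA
  by_contra! disj
  have a_lt_b : q a < p b := disj a ha b hb hab
  have b'_lt_a' : q b' < p a' := lt_of_not_ge fun h => (disj a' ha' b' hb' h).not_ge hba'
  obtain h | b_lt_a' := le_or_gt (p a') (q b)
  · have hmem : a' ∈ B := hB b' hb' b hb a' ha' b'_lt_a' (disj a' ha' b hb h)
    have hpq := hle a' (Or.inl ha')
    exact (disj a' ha' a' hmem hpq).not_ge hpq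
  · have hmem : b ∈ A := hA a ha a' ha' b hb a_lt_b b_lt_a'
    have hpq := hle b (Or.inr hb)
    exact (disj b hmem b hb hpq).not_ge hpq

theorem IsFlippedModel.mem_core_iff (h : IsFlippedModel G K p q) (hv : v ∈ K) (hu : u ∉ K) :
    u ∈ core G K v ↔ (∃ a ∈ core G K v, p a ≤ p u) ∧ ∃ a ∈ core G K v, q u ≤ q a := by
  have mem_iff {a} (ha : a ∉ K) : a ∈ core G K v ↔ p v < p a ∧ q a < q v := by
    rw [core_of_mem hv, Set.mem_compl_iff, h.notMem_closedNbhd_iff v hv a ha]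
  refine ⟨fun hmem => ⟨⟨u, hmem, le_rfl⟩, u, hmem, le_rfl⟩, ?_⟩
  rintro ⟨⟨a, ha, hau⟩, b, hb, hub⟩
  have hva := (mem_iff (notMem_of_mem_core h.isClique ha)).1 ha
  have hvb := (mem_iff (notMem_of_mem_core h.isClique hb)).1 hb
  exact (mem_iff hu).2 ⟨hva.1.trans_le hau, hub.trans_lt hvb.2⟩

theorem IsFlippedModel.mem_core_of_between (h : IsFlippedModel G K p q) {a b : V}
    (ha : a ∈ core G K v) (hb : b ∈ core G K v) (hu : u ∉ K) (hau : q a < p u) (hub : q u < p b) :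
    u ∈ core G K v := by
  have hpa := h.le (notMem_of_mem_core h.isClique ha)
  have hpb := h.le (notMem_of_mem_core h.isClique hb)
  by_cases hv : v ∈ K
  · exact (h.mem_core_iff hv hu).2
      ⟨⟨a, ha, hpa.trans hau.le⟩, b, hb, hub.le.trans hpb⟩
  · rw [core_of_notMem hv, Set.mem_singleton_iff] at ha hb
    subst ha hb
    exact absurd (hau.trans_le (h.le hu) |>.trans hub) hpb.not_gt

theorem IsFlippedModel.auxGraph_adj_iff (h : IsFlippedModel G K p q) (hne : u ≠ v) :
    (auxGraph G K).Adj u v ↔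
      (∃ a ∈ core G K u, ∃ b ∈ core G K v, p a ≤ q b) ∧
        ∃ b ∈ core G K v, ∃ a ∈ core G K u, p b ≤ q a := by
  have outer {a w} (ha : a ∈ core G K w) : a ∉ K := notMem_of_mem_core h.isClique ha
  rw [CircArc.auxGraph_adj_iff h.isClique hne]
  constructor
  · rintro ⟨a, ha, b, hb, hab⟩
    obtain ⟨hpq, hpq'⟩ := (h.mem_closedNbhd_iff a (outer ha) b (outer hb)).1 hab
    exact ⟨⟨a, ha, b, hb, hpq⟩, b, hb, a, ha, hpq'⟩
  · rintro ⟨huv, hvu⟩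
    obtain ⟨a, ha, b, hb, hab⟩ := exists_le_and_le_of_crossing
      (fun i hi => h.le (hi.elim outer outer))
      (fun a ha a' ha' b hb => h.mem_core_of_between ha ha' (outer hb))
      (fun b hb b' hb' a ha => h.mem_core_of_between hb hb' (outer ha)) huv hvu
    exact ⟨a, ha, b, hb, (h.mem_closedNbhd_iff a (outer ha) b (outer hb)).2 hab⟩

end Hull

section Cut

variable {V α : Type*} [LinearOrder α] {G : SimpleGraph V} {K : Set V} {p q : V → α} {u v : V}

theorem toLex_lt_toLex_iff_of_lt {α β : Type*} [PartialOrder α] [Preorder β] {s t : α} {i j : β}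
    (hij : i < j) : toLex (s, i) < toLex (t, j) ↔ s ≤ t := by
  simp [Prod.Lex.toLex_lt_toLex, hij, le_iff_lt_or_eq]

theorem lowerClosure_le_compl_upperClosure_iff {α : Type*} [Preorder α] {s t : Set α} :
    lowerClosure t ≤ (upperClosure s).compl ↔ ∀ a ∈ s, ∀ b ∈ t, ¬ a ≤ b := by
  simp only [lowerClosure_le, Set.subset_def, SetLike.mem_coe, UpperSet.mem_compl_iff,
    mem_upperClosure, not_exists, not_and]
  exact ⟨fun h a ha b hb => h b hb a ha, fun h b hb a ha => h a ha b hb⟩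

open Classical in
/-- The left end of the hull of the intervals `[p a, q a]`, `a ∈ core G K v`, as a cut of `α` (the
elements lying to its left). The ranks of coinciding cuts make all right ends precede all left ends,
so that touching cuts do not meet, and make the hull of `v ∈ K` strictly extend the intervals of the
vertices outside `K` that share an end with it. -/
noncomputable def leftEnd (G : SimpleGraph V) (K : Set V) (p : V → α) (v : V) :
    LowerSet α ×ₗ ℕ :=
  toLex ((upperClosure (p '' core G K v)).compl, if v ∈ K then 2 else 3)

open Classical in
/-- The right end of the hull of the intervals `[p a, q a]`, `a ∈ core G K v`; see `leftEnd`. -/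
noncomputable def rightEnd (G : SimpleGraph V) (K : Set V) (q : V → α) (v : V) :
    LowerSet α ×ₗ ℕ :=
  toLex (lowerClosure (q '' core G K v), if v ∈ K then 1 else 0)

theorem leftEnd_le_rightEnd_iff :
    leftEnd G K p u ≤ rightEnd G K q v ↔ ∃ a ∈ core G K u, ∃ b ∈ core G K v, p a ≤ q b := by
  rw [← not_lt, leftEnd, rightEnd, toLex_lt_toLex_iff_of_lt (by split_ifs <;> norm_num),
    lowerClosure_le_compl_upperClosure_iff]
  simp

theorem leftEnd_lt_leftEnd_iff (hv : v ∈ K) (hu : u ∉ K) :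
    leftEnd G K p v < leftEnd G K p u ↔ ∃ a ∈ core G K v, p a ≤ p u := by
  rw [leftEnd, leftEnd, if_pos hv, if_neg hu, toLex_lt_toLex_iff_of_lt (by norm_num),
    UpperSet.compl_le_compl, core_of_notMem hu]
  simp

theorem rightEnd_lt_rightEnd_iff (hv : v ∈ K) (hu : u ∉ K) :
    rightEnd G K q u < rightEnd G K q v ↔ ∃ a ∈ core G K v, q u ≤ q a := by
  rw [rightEnd, rightEnd, if_pos hv, if_neg hu, toLex_lt_toLex_iff_of_lt (by norm_num),
    core_of_notMem hu]
  simp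

theorem exists_real_le_iff_le {ι L : Type*} [Countable ι] [LinearOrder L] (g : ι → L) :
    ∃ f : ι → ℝ, ∀ i j, f i ≤ f j ↔ g i ≤ g j := by
  have := (Set.countable_range g).to_subtype
  obtain ⟨e⟩ := Order.embedding_from_countable_to_dense (Set.range g) ℝ
  exact ⟨fun i => e ⟨g i, i, rfl⟩, fun i j => e.le_iff_le⟩

theorem satisfiesSharp_of_linearOrder [Countable V] {L : Type*} [LinearOrder L] {l r : V → L}
    (hle : ∀ v, l v ≤ r v)
    (hadj : ∀ u v, u ≠ v → ((auxGraph G K).Adj u v ↔ l u ≤ r v ∧ l v ≤ r u))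
    (hext : ∀ v ∈ K, ∀ u ∉ K, (l v < l u ∧ r u < r v ↔ ¬ G.Adj u v)) :
    SatisfiesSharp G K := by
  obtain ⟨f, hf⟩ := exists_real_le_iff_le (Sum.elim l r)
  have hfle (v : V) : f (.inl v) ≤ f (.inr v) := (hf _ _).2 (hle v)
  refine ⟨⟨fun v => f (.inl v), fun v => f (.inr v), hfle, fun u v hne => ?_⟩,
    fun v hv u hu => ?_⟩
  · rw [Icc_inter_Icc_nonempty_iff (hfle u) (hfle v), hf, hf]
    exact hadj u v hne
  · simp only [IntervalModel.DoublyExtends, hfle, true_and, ← hext v hv u hu, ← not_le, hf,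
      Sum.elim_inl, Sum.elim_inr]

theorem IsFlippedModel.satisfiesSharp [Countable V] (h : IsFlippedModel G K p q)
    (huniv : ∀ v ∈ K, ¬ G.IsUniversal v) : SatisfiesSharp G K := by
  refine satisfiesSharp_of_linearOrder (l := leftEnd G K p) (r := rightEnd G K q) (fun v => ?_)
    (fun u v hne => ?_) fun v hv u hu => ?_
  · obtain ⟨a, ha⟩ := core_nonempty (huniv v)
    exact leftEnd_le_rightEnd_iff.2 ⟨a, ha, a, ha, h.le (notMem_of_mem_core h.isClique ha)⟩
  · rw [leftEnd_le_rightEnd_iff, leftEnd_le_rightEnd_iff, h.auxGraph_adj_iff hne]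
  · rw [leftEnd_lt_leftEnd_iff hv hu, rightEnd_lt_rightEnd_iff hv hu, ← h.mem_core_iff hv hu,
      core_of_mem hv, Set.mem_compl_iff, mem_closedNbhd_iff_adj (ne_of_mem_of_not_mem hv hu),
      G.adj_comm]

end Cut

end CircArc

theorem theorem2_general {V : Type*} [Countable V] (G : SimpleGraph V) :
    CircArc.IsCircularArcGraph G ↔
      ∃ K : Set V, G.IsClique K ∧ CircArc.SatisfiesSharp G K := by
  constructor
  · intro h
    obtain ⟨_, _, _, hmodel⟩ := h.exists_isFlippedModel
    obtain ⟨K, p, q, hmodel', huniv, -⟩ := hmodel.exists_forall_not_isUniversal_and_mem_Ioo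
    exact ⟨K, hmodel'.isClique, hmodel'.satisfiesSharp huniv⟩
  · rintro ⟨K, hK, hsharp⟩
    obtain ⟨p, q, hmodel⟩ := hsharp.exists_isFlippedModel hK
    exact hmodel.isCircularArcGraph

theorem theorem2 {V : Type*} [Finite V] (G : SimpleGraph V)
    (hG : ∀ v : V, ¬ G.IsUniversal v) :
    CircArc.IsCircularArcGraph G ↔
      ∃ K : Set V, G.IsClique K ∧ CircArc.SatisfiesSharp G K :=
  theorem2_general G
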